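/- Let $K$ be a real-closed field with a (possibly trivial) valuation $v\colon K\to\mathbf{R}\cup\{\infty\}$ whose valuation ring $\mathcal{O}_K=\{x\in K: v(x)\ge 0\}$ is convex for the ordering of $K$, i.e. $\mathcal{O}_K=\{x\in K:\ x\le a \text{ and } -x\le a\text{ for some }a\in\mathcal{O}_K\}$. Let $P(x)=\sum_{i=0}^n c_ix^i\in K[x]$ be a non-zero polynomial. The Newton polygon of $P$ is the lower convex hull of the points $(i,v(c_i))$ with $c_i\ne 0$, i.e. the set of points of $\mathbf{R}^2$ satisfying all linear inequalities with normal vector in the closed upper half-plane that hold at these points; its edges are its bounded one-dimensional faces. For an edge $\sigma$ of slope $\lambda$, the initial form of $P$ along $\sigma$ is $\mathrm{In}_\sigma(P)=\sum c_ix^i$, where the sum is over those $i$ with $c_i\neq 0$ for which $v(c_i)-\lambda i$ is minimal. For a polynomial $p$ over $K$, let $\Delta(p)$ be the number of sign changes in its sequence of coefficients, ignoring zeros. Then: 1. for every non-zero root $\alpha\in K$ of $P$ there is an edge of the Newton polygon of $P$, with slope $\lambda$ say, such that $v(\alpha)=-\lambda$; 2. for every edge $\sigma$ of the Newton polygon of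 $P$, with slope $\lambda$ say, the number of roots $\alpha\in K$ of $P$, counted with multiplicity, with $\alpha>0$ and $v(\alpha)=-\lambda$ is at most $\Delta(\mathrm{In}_\sigma(P))$, and the two numbers are congruent modulo $2$. -/

import Mathlib

open Polynomial

namespace NewtonSigns

/-- The ring `{x | 0 ≤ v x}` of a valuation `v : K → ℝ ∪ {∞}`. -/
def valuationRing {K : Type*} [Field K] (v : AddValuation K (WithTop ℝ)) : Subring K where
  carrier := {x | 0 ≤ v x}
  mul_mem' := by
    intro a b ha hb
    change 0 ≤ v (a * b)
    rw [v.map_mul]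
    exact add_nonneg ha hb
  one_mem' := by simp
  add_mem' := fun ha hb => v.map_le_add ha hb
  zero_mem' := by simp
  neg_mem' := by
    intro a ha
    simpa using ha

/-- The convex hull of a subring `R` with respect to the ordering of `K`. -/
def orderConvexHull {K : Type*} [Field K] [LinearOrder K] (R : Subring K) : Set K :=
  {x | ∃ a ∈ R, x ≤ a ∧ -x ≤ a}

/-- A subring is convex if it equals its convex hull. -/
def IsConvexSubring {K : Type*} [Field K] [LinearOrder K] (R : Subring K) : Prop :=
  (R : Set K) = orderConvexHull R

/-- The points `(i, v (c_i))` of the plane attached to `P = ∑ c_i x ^ i`. A coefficient `c_i = 0`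
has `v (c_i) = ∞` and gives no point. -/
def newtonPoints {K : Type*} [Field K] (v : AddValuation K (WithTop ℝ)) (P : K[X]) :
    Set (ℝ × ℝ) :=
  {z | ∃ i : ℕ, z.1 = (i : ℝ) ∧ v (P.coeff i) = ((z.2 : ℝ) : WithTop ℝ)}

/-- The lower convex hull of a set of points of the plane: the set cut out by all valid linear
inequalities `b ≤ ⟨u, z⟩` whose normal vector `u` lies in the (closed) upper half-plane. -/
def lowerConvexHull (S : Set (ℝ × ℝ)) : Set (ℝ × ℝ) :=
  {z | ∀ u : ℝ × ℝ, 0 ≤ u.2 → ∀ b : ℝ,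
    (∀ s ∈ S, b ≤ u.1 * s.1 + u.2 * s.2) → b ≤ u.1 * z.1 + u.2 * z.2}

/-- The Newton polygon of `P`. -/
def newtonPolygon {K : Type*} [Field K] (v : AddValuation K (WithTop ℝ)) (P : K[X]) :
    Set (ℝ × ℝ) :=
  lowerConvexHull (newtonPoints v P)

/-- `σ` is a (bounded) edge of the Newton polygon `N`: a bounded exposed face with more than one
point. As a Newton polygon is unbounded or empty, such a face is a line segment. -/
def IsEdge (N σ : Set (ℝ × ℝ)) : Prop :=
  IsExposed ℝ N σ ∧ Bornology.IsBounded σ ∧ σ.Nontrivial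

/-- The segment `σ` has slope `s`. -/
def HasSlope (σ : Set (ℝ × ℝ)) (s : ℝ) : Prop :=
  ∀ z ∈ σ, ∀ w ∈ σ, w.2 - z.2 = s * (w.1 - z.1)

open Classical in
/-- The initial form `In_a(P)`: the sum of the monomials `c_i x ^ i` of `P` (with `c_i ≠ 0`) for
which `v (c_i) + a * i` is minimal. -/
noncomputable def initialForm {K : Type*} [Field K] (v : AddValuation K (WithTop ℝ)) (a : ℝ)
    (P : K[X]) : K[X] :=
  ∑ i ∈ P.support with ∀ j ∈ P.support,
      v (P.coeff i) + ((a * i : ℝ) : WithTop ℝ) ≤ v (P.coeff j) + ((a * j : ℝ) : WithTop ℝ),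
    monomial i (P.coeff i)

end NewtonSigns

/-!
Let `a` be a real number. The initial form of `P` along an edge of slope `-a` collects the terms
`c_k x ^ k` for which `v (c_k) + a * k` is minimal, that is, the terms which have minimal valuation at
elements `x` with `v x = a`. All the information needed is in the signs of the coefficients and in
the set of minimal exponents, whose ends are recorded by `HasEnds`.

If `P(α) = 0` and `v α = a`, the minimum is attained at two exponents, since a single dominant term
could not be cancelled. The supporting line of slope `-a` then meets the Newton polygon in an edge.

As the valuation ring is convex, `v` is antitone in the absolute value, so that a term of least
valuation determines the sign of a sum. This has two consequences for the number `r` of positive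
roots of valuation `a`; both hold for every real `a`.

* Parity (`card_roots_modEq_signVariations_initialForm`). The number of sign changes of the initial
  form is even or odd according to whether its lowest and leading coefficients have equal or
  opposite signs. The product of these two signs is multiplicative in `P` (`HasEnds.mul`), as is
  `(-1) ^ r`. So it is enough to compare them for irreducible `P`. Over a real closed field these are
  linear or quadratic (`natDegree_le_two_of_irreducible`, by Galois theory and Sylow's theorem). For
  a quadratic without roots, `c_1 ^ 2 < 4 * c_0 * c_2` shows that `c_0` and `c_2` have the same sign
  and that the middle exponent is never an end of the initial form.
* Upper bound (`card_roots_le_signVariations_initialForm`). As in Descartes' rule of signs, each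
  factor `X - α` with `α > 0` and `v α = a` adds at least one sign change to the initial form
  (`exists_alternates_X_sub_C_mul`). The initial form of `(X - α) * Q` need not be the product of
  the initial forms, because terms may cancel to higher valuation; hence the argument uses only the
  beginnings and ends of blocks of equal signs, which such a cancellation does not affect.
-/

open Polynomial

namespace NewtonSigns

/-! ### Irreducible polynomials over a real closed field -/

section RealClosed
variable {K : Type*} [Field K] [LinearOrder K] [IsStrictOrderedRing K] [IsRealClosed K]

lemma finrank_eq_one_of_odd (F : Type*) [Field F] [Algebra K F] [FiniteDimensional K F]
    (h : Odd (Module.finrank K F)) : Module.finrank K F = 1 := by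
  obtain ⟨θ, hθ⟩ := Field.exists_primitive_element K F
  rw [Field.primitive_element_iff_minpoly_natDegree_eq] at hθ
  have hint := Algebra.IsIntegral.isIntegral (R := K) θ
  obtain ⟨x, hx⟩ := IsRealClosed.exists_isRoot_of_odd_natDegree (f := minpoly K θ) (by rwa [hθ])
  rw [← hθ]
  exact natDegree_eq_of_degree_eq_some
    (degree_eq_one_of_irreducible_of_root (minpoly.irreducible hint) hx)

/-- Every element of `K[√-1]` is a square. The square root `u + w √-1` of `x + y √-1` has
`u ^ 2 = (r + x) / 2` and `w ^ 2 = (r - x) / 2` for `r = √(x ^ 2 + y ^ 2)`. -/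
lemma exists_sq_eq_add_mul {L : Type*} [Field L] [Algebra K L] {I : L} (hI : I ^ 2 = -1)
    (x y : K) : ∃ u w : K, (algebraMap K L u + algebraMap K L w * I) ^ 2 =
      algebraMap K L x + algebraMap K L y * I := by
  obtain ⟨r, hr⟩ := IsRealClosed.nonneg_iff_isSquare.1 (show 0 ≤ x ^ 2 + y ^ 2 by positivity)
  wlog hr0 : 0 ≤ r generalizing r
  · exact this (-r) (by rw [hr]; ring) (by linarith)
  have hxr : |x| ≤ r := abs_le_of_sq_le_sq (by nlinarith [sq_nonneg y]) hr0
  obtain ⟨h1, h2⟩ := abs_le.1 hxr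
  obtain ⟨u, hu⟩ := IsRealClosed.nonneg_iff_isSquare.1 (show 0 ≤ (r + x) / 2 by linarith)
  obtain ⟨w, hw⟩ := IsRealClosed.nonneg_iff_isSquare.1 (show 0 ≤ (r - x) / 2 by linarith)
  have key : (2 * (u * w)) ^ 2 = y ^ 2 := by
    have : (2 * (u * w)) ^ 2 = 4 * (u * u) * (w * w) := by ring
    rw [this, ← hu, ← hw]
    linear_combination -hr
  have main : ∀ w' : K, w' * w' = w * w → 2 * (u * w') = y →
      (algebraMap K L u + algebraMap K L w' * I) ^ 2 =
        algebraMap K L x + algebraMap K L y * I := by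
    intro w' hw' hy
    have hx : x = u * u - w' * w' := by rw [hw', ← hu, ← hw]; ring
    rw [hx, ← hy]
    simp only [map_sub, map_mul, map_ofNat]
    linear_combination (algebraMap K L w') ^ 2 * hI
  rcases sq_eq_sq_iff_eq_or_eq_neg.1 key with h | h
  · exact ⟨u, w, main w rfl h⟩
  · exact ⟨u, -w, main (-w) (by ring) (by linear_combination -h)⟩

lemma isSquare_adjoin_sqrt_neg_one {L : Type*} [Field L] [Algebra K L] {I : L}
    (hI : I ^ 2 = -1) (z : IntermediateField.adjoin K {I}) : IsSquare z := by
  have hmonic : (X ^ 2 + 1 : K[X]).Monic := by monicity!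
  have hroot : aeval I (X ^ 2 + 1 : K[X]) = 0 := by simp [hI]
  have hint : IsIntegral K I := ⟨_, hmonic, by simpa [aeval_def] using hroot⟩
  have hz := z.2
  rw [← IntermediateField.mem_toSubalgebra,
    IntermediateField.adjoin_simple_toSubalgebra_of_isAlgebraic hint.isAlgebraic,
    Algebra.adjoin_singleton_eq_range_aeval] at hz
  obtain ⟨q, hq⟩ := hz
  have hq' : aeval I q = aeval I (q %ₘ (X ^ 2 + 1)) := by
    conv_lhs => rw [← modByMonic_add_div q (X ^ 2 + 1)]
    simp [hroot]
  have hdeg : (q %ₘ (X ^ 2 + 1)).degree ≤ 1 := by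
    have h1 := degree_modByMonic_lt q hmonic
    have h2 : (X ^ 2 + 1 : K[X]).degree = 2 := by compute_degree!
    rw [h2] at h1
    exact Order.le_of_lt_succ h1
  rw [eq_X_add_C_of_degree_le_one hdeg] at hq'
  obtain ⟨u, w, huw⟩ := exists_sq_eq_add_mul hI ((q %ₘ (X ^ 2 + 1)).coeff 0)
    ((q %ₘ (X ^ 2 + 1)).coeff 1)
  have hI' : I ∈ IntermediateField.adjoin K {I} := IntermediateField.mem_adjoin_simple_self K I
  refine ⟨algebraMap K _ u + algebraMap K _ w * ⟨I, hI'⟩, Subtype.ext ?_⟩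
  have : (z : L) = algebraMap K L ((q %ₘ (X ^ 2 + 1)).coeff 0) +
      algebraMap K L ((q %ₘ (X ^ 2 + 1)).coeff 1) * I := by
    refine hq.symm.trans (hq'.trans ?_)
    simp [add_comm]
  rw [this, ← huw, sq]
  rfl

lemma finrank_ne_two_of_isSquare {E M : Type*} [Field E] [CharZero E] [Field M] [Algebra E M]
    (hsq : ∀ z : E, IsSquare z) : Module.finrank E M ≠ 2 := by
  intro h
  have : FiniteDimensional E M := Module.finite_of_finrank_pos (by omega)
  obtain ⟨θ, hθ⟩ := Field.exists_primitive_element E M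
  rw [Field.primitive_element_iff_minpoly_natDegree_eq, h] at hθ
  have hirr := minpoly.irreducible (Algebra.IsIntegral.isIntegral (R := E) θ)
  have hmon := minpoly.monic (Algebra.IsIntegral.isIntegral (R := E) θ)
  set p := minpoly E θ
  obtain ⟨d, hd⟩ := hsq (p.coeff 1 ^ 2 - 4 * p.coeff 0)
  have hroot : p.IsRoot ((d - p.coeff 1) / 2) := by
    have hlead : p.coeff 2 = 1 := by rw [← hθ]; exact hmon
    rw [IsRoot, eval_eq_sum_range, hθ]
    simp only [Finset.sum_range_succ, Finset.sum_range_zero, hlead]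
    field_simp
    linear_combination -hd
  have h1 : p.natDegree = 1 :=
    natDegree_eq_of_degree_eq_some (degree_eq_one_of_irreducible_of_root hirr hroot)
  omega

/-- The fixed field of a Sylow 2-subgroup has odd degree over `K`, hence is `K`. -/
lemma finrank_eq_two_pow (L : Type*) [Field L] [Algebra K L] [FiniteDimensional K L]
    [IsGalois K L] : ∃ n, Module.finrank K L = 2 ^ n := by
  have : Fact (Nat.Prime 2) := ⟨Nat.prime_two⟩
  let H : Sylow 2 Gal(L/K) := default
  let F := IntermediateField.fixedField (H : Subgroup Gal(L/K))
  have hFL : Module.finrank F L = Nat.card (H : Subgroup Gal(L/K)) :=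
    IntermediateField.finrank_fixedField_eq_card _
  obtain ⟨n, hn⟩ := (IsPGroup.iff_card (p := 2)).1 H.isPGroup'
  have hF : Module.finrank K F = (H : Subgroup Gal(L/K)).index := by
    rw [IntermediateField.finrank_eq_fixingSubgroup_index,
      IntermediateField.fixingSubgroup_fixedField]
  have hodd : Odd (Module.finrank K F) := by
    rw [hF, Nat.odd_iff]
    have := H.not_dvd_index
    omega
  refine ⟨n, ?_⟩
  rw [← Module.finrank_mul_finrank K F L, finrank_eq_one_of_odd F hodd, hFL, one_mul]
  exact hn

/-- If the 2-group `Gal(L/K(√-1))` were not trivial, a subgroup of index 2 would give a quadratic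
extension of `K(√-1)`, where all elements are squares. -/
lemma finrank_le_two (L : Type*) [Field L] [Algebra K L] [FiniteDimensional K L] [IsGalois K L]
    {I : L} (hI : I ^ 2 = -1) : Module.finrank K L ≤ 2 := by
  have : Fact (Nat.Prime 2) := ⟨Nat.prime_two⟩
  let E := IntermediateField.adjoin K {I}
  have hmonic : (X ^ 2 + 1 : K[X]).Monic := by monicity!
  have hroot : aeval I (X ^ 2 + 1 : K[X]) = 0 := by simp [hI]
  have hint : IsIntegral K I := ⟨_, hmonic, by simpa [aeval_def] using hroot⟩
  have hE : Module.finrank K E ≤ 2 := by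
    rw [IntermediateField.adjoin.finrank hint]
    refine (natDegree_le_of_dvd (minpoly.dvd K I hroot) hmonic.ne_zero).trans ?_
    compute_degree!
  obtain ⟨n, hn⟩ := finrank_eq_two_pow (K := K) L
  have hmul := Module.finrank_mul_finrank K E L
  obtain ⟨k, -, hk⟩ := (Nat.dvd_prime_pow Nat.prime_two).1 (hn ▸ Dvd.intro_left _ hmul)
  rcases k with _ | k
  · rw [← hmul, hk]
    omega
  · exfalso
    have hcard : Nat.card Gal(L/E) = 2 ^ (k + 1) := by
      rw [IsGalois.card_aut_eq_finrank, hk]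
    obtain ⟨H, hH⟩ := Sylow.exists_subgroup_card_pow_prime (G := Gal(L/E)) 2 (n := k)
      (by rw [hcard]; exact pow_dvd_pow 2 (Nat.le_succ k))
    have hM := IntermediateField.finrank_fixedField_eq_card H
    have hmul' := Module.finrank_mul_finrank E (IntermediateField.fixedField H) L
    rw [hM, hH, hk, pow_succ'] at hmul'
    have : CharZero E := algebraRat.charZero E
    exact finrank_ne_two_of_isSquare (isSquare_adjoin_sqrt_neg_one hI)
      (Nat.eq_of_mul_eq_mul_right (by positivity) hmul')

/-- The part of the fundamental theorem of algebra for real closed fields that is needed here. -/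
theorem natDegree_le_two_of_irreducible {p : K[X]} (hp : Irreducible p) : p.natDegree ≤ 2 := by
  let f : K[X] := p * (X ^ 2 + 1)
  let L := f.SplittingField
  have hf0 : f ≠ 0 := mul_ne_zero hp.ne_zero (by
    have hmonic : (X ^ 2 + 1 : K[X]).Monic := by monicity!
    exact hmonic.ne_zero)
  have hsplit : (f.map (algebraMap K L)).Splits := SplittingField.splits f
  have : Normal K L := Normal.of_isSplittingField f
  have : IsGalois K L := ⟨⟩
  have hs : ∀ g : K[X], g ∣ f → g.degree ≠ 0 → ∃ x : L, aeval x g = 0 := by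
    intro g hg hd
    have h := hsplit.of_dvd (map_ne_zero hf0) (Polynomial.map_dvd _ hg)
    obtain ⟨x, hx⟩ := h.exists_eval_eq_zero (by rwa [degree_map])
    exact ⟨x, by rwa [eval_map_algebraMap] at hx⟩
  obtain ⟨I, hI⟩ := hs (X ^ 2 + 1) (Dvd.intro_left _ rfl) (by
    have h2 : (X ^ 2 + 1 : K[X]).degree = 2 := by compute_degree!
    rw [h2]; decide)
  obtain ⟨x, hx⟩ := hs p (Dvd.intro _ rfl) hp.degree_pos.ne'
  have hI' : I ^ 2 = -1 := by
    simp at hI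
    linear_combination hI
  have hle := finrank_le_two (K := K) L hI'
  have hdvd : p ∣ minpoly K x :=
    (minpoly.irreducible (Algebra.IsIntegral.isIntegral x)).dvd_symm hp (minpoly.dvd K x hx)
  exact (natDegree_le_of_dvd hdvd (minpoly.ne_zero (Algebra.IsIntegral.isIntegral x))).trans
    ((minpoly.natDegree_le x).trans hle)

end RealClosed

/-! ### Sign changes and alternating chains -/

section Signs

/-- `s` takes the alternating values `ε, -ε, ε, …` along some `n` indices below `N`, read from the
largest index down. -/
def Alternates (s : ℕ → SignType) : ℕ → SignType → ℕ → Prop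
  | 0, _, _ => True
  | n + 1, ε, N => ∃ i < N, s i = ε ∧ Alternates s n (-ε) i

lemma Alternates.mono {s : ℕ → SignType} {n : ℕ} {ε : SignType} {M N : ℕ} (hMN : M ≤ N)
    (h : Alternates s n ε M) : Alternates s n ε N := by
  cases n with
  | zero => trivial
  | succ n =>
    obtain ⟨i, hi, h⟩ := h
    exact ⟨i, hi.trans_le hMN, h⟩

lemma Alternates.congr {s t : ℕ → SignType} {n : ℕ} {ε : SignType} {N : ℕ}
    (hst : ∀ i < N, s i = t i) (h : Alternates s n ε N) : Alternates t n ε N := by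
  induction n generalizing ε N with
  | zero => trivial
  | succ n ih =>
    obtain ⟨i, hi, hs, h⟩ := h
    exact ⟨i, hi, hst i hi ▸ hs, ih (fun k hk => hst k (hk.trans hi)) h⟩

lemma signType_ne_neg_self {ε : SignType} (hε : ε ≠ 0) : ε ≠ -ε := by
  revert hε; cases ε <;> decide

lemma signType_eq_neg {δ ε : SignType} (hδ : δ ≠ 0) (hε : ε ≠ 0) (h : δ ≠ ε) : δ = -ε := by
  revert δ ε
  decide

/-- Here `s` and `t` stand for the signs of the initial forms of `Q` and `(X - α) * Q` with `α > 0`.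
Where a block of signs `ε` of `s` begins, `t` has the sign `-ε`; moving each index of a chain down
to the beginning of a block gives a chain of the opposite signs for `t`. -/
lemma Alternates.neg_of_mul {s t : ℕ → SignType}
    (hrise : ∀ l ε, ε ≠ 0 → s l = ε → (∀ k, l = k + 1 → s k ≠ ε) → t l = -ε)
    {n : ℕ} {ε : SignType} (hε : ε ≠ 0) {N : ℕ} (h : Alternates s n ε N) :
    Alternates t n (-ε) N := by
  induction n generalizing ε N with
  | zero => trivial
  | succ n ih =>
    classical
    have hex : ∃ i, s i = ε ∧ Alternates s n (-ε) i := by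
      obtain ⟨i, -, h⟩ := h
      exact ⟨i, h⟩
    obtain ⟨i, hi, h⟩ := h
    have hle : Nat.find hex ≤ i := Nat.find_min' hex h
    obtain ⟨h1, h2⟩ := Nat.find_spec hex
    refine ⟨Nat.find hex, hle.trans_lt hi, hrise _ ε hε h1 ?_, ih (by simpa using hε) h2⟩
    intro k hk hsk
    refine Nat.find_min hex (show k < Nat.find hex by omega) ⟨hsk, ?_⟩
    cases n with
    | zero => trivial
    | succ n =>
      obtain ⟨j, hj, hsj, h⟩ := h2
      refine ⟨j, ?_, hsj, h⟩
      have : j ≠ k := by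
        rintro rfl
        exact signType_ne_neg_self hε (hsk.symm.trans hsj)
      omega

/-- Where a block of signs `ε` of `s` ends, `t` has the sign `ε`; so the end of the block of the top
index prolongs the chain of `Alternates.neg_of_mul` by one. -/
lemma Alternates.succ_of_mul {s t : ℕ → SignType}
    (hrise : ∀ l ε, ε ≠ 0 → s l = ε → (∀ k, l = k + 1 → s k ≠ ε) → t l = -ε)
    (hfall : ∀ k ε, ε ≠ 0 → s k = ε → s (k + 1) ≠ ε → t (k + 1) = ε)
    {B : ℕ} (hB : ∀ i, B ≤ i → s i = 0)
    {n : ℕ} {ε : SignType} (hε : ε ≠ 0) {N : ℕ} (h : Alternates s (n + 1) ε N) :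
    ∃ M, Alternates t (n + 2) ε M := by
  obtain ⟨i, -, hi, h⟩ := h
  have hex : ∃ k, i ≤ k ∧ s (k + 1) ≠ ε :=
    ⟨max i B, le_max_left _ _, by rw [hB _ (by omega)]; exact hε.symm⟩
  classical
  obtain ⟨h1, h2⟩ := Nat.find_spec hex
  have hk : s (Nat.find hex) = ε := by
    rcases h1.eq_or_lt with h' | h'
    · rwa [← h']
    · have := Nat.find_min hex (show Nat.find hex - 1 < Nat.find hex by omega)
      push Not at this
      have := this (by omega)
      rwa [show Nat.find hex - 1 + 1 = Nat.find hex by omega] at this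
  have h' : Alternates s (n + 1) ε (i + 1) := ⟨i, by omega, hi, h⟩
  exact ⟨Nat.find hex + 1 + 1, Nat.find hex + 1, by omega, hfall _ ε hε hk h2,
    (h'.neg_of_mul hrise hε).mono (by omega)⟩

variable {R : Type*} [Ring R] [LinearOrder R]

/-- A chain of length `n` forces `n - 1` sign changes. The extra term records whether the chain can
start at the leading coefficient, which makes the induction on `eraseLead` work. -/
lemma Alternates.le_signVariations_add {p : R[X]} (hp : p ≠ 0) {n : ℕ} {ε : SignType}
    (hε : ε ≠ 0) {N : ℕ} (h : Alternates (fun i => SignType.sign (p.coeff i)) n ε N) :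
    n ≤ p.signVariations + if SignType.sign p.leadingCoeff = ε then 1 else 0 := by
  induction hd : p.support.card generalizing p n ε N with
  | zero => simp_all
  | succ d ih =>
    cases n with
    | zero => omega
    | succ n =>
      have hlead : ∀ i, p.natDegree < i → SignType.sign (p.coeff i) = 0 := fun i hi => by
        rw [coeff_eq_zero_of_natDegree_lt hi, sign_zero]
      have hcoeff : ∀ i < p.natDegree, SignType.sign (p.coeff i) =
          SignType.sign (p.eraseLead.coeff i) := fun i hi => by
        rw [eraseLead_coeff_of_ne _ hi.ne]
      have hcard : p.eraseLead.support.card = d := by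
        rw [card_support_eraseLead' hd]
      rw [signVariations_eq_eraseLead_add_ite hp]
      obtain ⟨i, hi, hs, h⟩ := h
      have hi' : i ≤ p.natDegree := by
        by_contra hlt
        exact hε (hs.symm.trans (hlead i (not_le.1 hlt)))
      by_cases hl : SignType.sign p.leadingCoeff = ε
      · have h' := (h.mono hi').congr hcoeff
        by_cases he : p.eraseLead = 0
        · rw [he] at h'
          cases n with
          | zero => simp [hl]
          | succ n =>
            obtain ⟨j, -, hj, -⟩ := h'
            simp [eq_comm, hε] at hj
        · have := ih he (by simpa using hε) h' hcard
          rw [if_pos hl]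
          have hiff : (SignType.sign p.leadingCoeff = -SignType.sign p.eraseLead.leadingCoeff) ↔
              SignType.sign p.eraseLead.leadingCoeff = -ε := by
            rw [hl, eq_comm, neg_eq_iff_eq_neg]
          rw [if_congr hiff rfl rfl]
          omega
      · have hi'' : i < p.natDegree := lt_of_le_of_ne hi' (by rintro rfl; exact hl hs)
        have h' : Alternates (fun i => SignType.sign (p.eraseLead.coeff i)) (n + 1) ε p.natDegree :=
          Alternates.congr hcoeff ⟨i, hi'', hs, h⟩
        have he : p.eraseLead ≠ 0 := by
          intro he
          rw [he] at h'
          obtain ⟨j, -, hj, -⟩ := h'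
          simp [eq_comm, hε] at hj
        have := ih he hε h' hcard
        rw [if_neg hl]
        split_ifs at this with h1
        · have hl' : SignType.sign p.leadingCoeff ≠ 0 := by
            simpa [sign_eq_zero_iff] using hp
          rw [if_pos, add_zero]
          · exact this
          · rw [h1]
            exact signType_eq_neg hl' hε hl
        · omega

/-- The parity of the number of sign changes is seen on the lowest and the leading coefficient. -/
lemma neg_one_pow_signVariations {p : R[X]} {i : ℕ} (hi : p.coeff i ≠ 0)
    (hlt : ∀ k < i, p.coeff k = 0) :
    (-1 : SignType) ^ p.signVariations =
      SignType.sign (p.coeff i) * SignType.sign p.leadingCoeff := by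
  induction hd : p.support.card generalizing p with
  | zero =>
    rw [Finset.card_eq_zero, support_eq_empty] at hd
    simp [hd] at hi
  | succ d ih =>
    have hp : p ≠ 0 := by rintro rfl; simp at hi
    have hl' : SignType.sign p.leadingCoeff ≠ 0 := by simpa [sign_eq_zero_iff] using hp
    rw [signVariations_eq_eraseLead_add_ite hp]
    rcases (le_natDegree_of_ne_zero hi).eq_or_lt with h | h
    · have he : p.eraseLead = 0 := by
        ext k
        rcases lt_trichotomy k p.natDegree with hk | hk | hk
        · rw [eraseLead_coeff_of_ne _ hk.ne, hlt k (h ▸ hk), coeff_zero]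
        · rw [hk, eraseLead_coeff_natDegree, coeff_zero]
        · rw [eraseLead_coeff_of_ne _ hk.ne', coeff_eq_zero_of_natDegree_lt hk, coeff_zero]
      rw [he, h]
      simp only [coeff_natDegree, signVariations_zero, leadingCoeff_zero, sign_zero]
      revert hl'
      generalize SignType.sign p.leadingCoeff = δ
      revert δ
      decide
    · have hei : p.eraseLead.coeff i = p.coeff i := eraseLead_coeff_of_ne _ h.ne
      have he : p.eraseLead ≠ 0 := by
        intro he
        rw [he] at hei
        exact hi (by simpa using hei.symm)
      have hel : SignType.sign p.eraseLead.leadingCoeff ≠ 0 := by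
        simpa [sign_eq_zero_iff] using he
      have := ih (hei ▸ hi) (fun k hk => by
        rw [eraseLead_coeff_of_ne _ (hk.trans h).ne, hlt k hk]) (card_support_eraseLead' hd)
      rw [pow_add, this, hei, mul_assoc]
      congr 1
      revert hl' hel
      generalize SignType.sign p.leadingCoeff = δ
      generalize SignType.sign p.eraseLead.leadingCoeff = δ'
      revert δ δ'
      decide

end Signs

/-! ### Inequalities in `ℝ ∪ {∞}` -/

section WithTopReal

lemma coe_add_lt_add {x y : ℝ} {A B : WithTop ℝ} (hx : (x : WithTop ℝ) ≤ A)
    (hy : (y : WithTop ℝ) < B) : ((x + y : ℝ) : WithTop ℝ) < A + B := by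
  cases A <;> cases B <;> simp_all [← WithTop.coe_add]
  linarith

lemma add_coe_le_coe_iff {A : WithTop ℝ} {r m : ℝ} :
    A + (r : WithTop ℝ) ≤ (m : WithTop ℝ) ↔ A ≤ ((m - r : ℝ) : WithTop ℝ) := by
  cases A
  · simp
  · norm_cast
    exact le_sub_iff_add_le.symm

lemma coe_le_add_coe_iff {A : WithTop ℝ} {r m : ℝ} :
    (m : WithTop ℝ) ≤ A + (r : WithTop ℝ) ↔ ((m - r : ℝ) : WithTop ℝ) ≤ A := by
  cases A
  · simp
  · norm_cast
    exact sub_le_iff_le_add.symm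

end WithTopReal

/-! ### The extreme exponents of an initial form -/

section Ends
variable {K : Type*} [Field K] {v : AddValuation K (WithTop ℝ)} {a : ℝ}

/-- The function `k ↦ v (c_k) + a * k` on the exponents of `P` has minimum `m`, and `i` and `j` are
the smallest and the largest exponent at which it is attained. -/
structure HasEnds (v : AddValuation K (WithTop ℝ)) (a : ℝ) (P : K[X]) (m : ℝ) (i j : ℕ) : Prop where
  le (k : ℕ) : ((m - a * k : ℝ) : WithTop ℝ) ≤ v (P.coeff k)
  bot : v (P.coeff i) = ((m - a * i : ℝ) : WithTop ℝ)
  top : v (P.coeff j) = ((m - a * j : ℝ) : WithTop ℝ)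
  lt_of_lt_bot (k : ℕ) (hk : k < i) : ((m - a * k : ℝ) : WithTop ℝ) < v (P.coeff k)
  lt_of_top_lt (k : ℕ) (hk : j < k) : ((m - a * k : ℝ) : WithTop ℝ) < v (P.coeff k)

lemma ne_zero_of_map_eq_coe {x : K} {r : ℝ} (h : v x = (r : WithTop ℝ)) : x ≠ 0 := by
  rintro rfl
  simp at h

lemma exists_hasEnds {P : K[X]} (hP : P ≠ 0) : ∃ m i j, HasEnds v a P m i j := by
  classical
  obtain ⟨k₀, hk₀, hmin⟩ := P.support.exists_min_image
    (fun k => v (P.coeff k) + ((a * k : ℝ) : WithTop ℝ)) (support_nonempty.2 hP)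
  obtain ⟨c, hc⟩ := WithTop.ne_top_iff_exists.1 (v.ne_top_iff.2 (mem_support_iff.1 hk₀))
  have hle : ∀ k : ℕ, ((c + a * k₀ - a * k : ℝ) : WithTop ℝ) ≤ v (P.coeff k) := by
    intro k
    by_cases hk : P.coeff k = 0
    · simp [hk]
    · rw [← coe_le_add_coe_iff]
      have := hmin k (mem_support_iff.2 hk)
      rwa [← hc, ← WithTop.coe_add] at this
  let T := P.support.filter
    (fun k => v (P.coeff k) = ((c + a * k₀ - a * k : ℝ) : WithTop ℝ))
  have hT : T.Nonempty := ⟨k₀, by simp only [T, Finset.mem_filter]; exact ⟨hk₀, by simp [← hc]⟩⟩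
  have hmem : ∀ k, k ∈ T ↔ v (P.coeff k) = ((c + a * k₀ - a * k : ℝ) : WithTop ℝ) := by
    intro k
    simp only [T, Finset.mem_filter, and_iff_right_iff_imp, mem_support_iff]
    exact ne_zero_of_map_eq_coe
  refine ⟨c + a * k₀, T.min' hT, T.max' hT, hle, (hmem _).1 (T.min'_mem hT),
    (hmem _).1 (T.max'_mem hT), fun k hk => ?_, fun k hk => ?_⟩
  · refine lt_of_le_of_ne (hle k) fun h => ?_
    exact absurd (T.min'_le k ((hmem k).2 h.symm)) (not_le.2 hk)
  · refine lt_of_le_of_ne (hle k) fun h => ?_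
    exact absurd (T.le_max' k ((hmem k).2 h.symm)) (not_le.2 hk)

lemma HasEnds.coeff_initialForm {P : K[X]} {m : ℝ} {i j : ℕ} (h : HasEnds v a P m i j) (k : ℕ)
    [Decidable (v (P.coeff k) = ((m - a * k : ℝ) : WithTop ℝ))] :
    (initialForm v a P).coeff k =
      if v (P.coeff k) = ((m - a * k : ℝ) : WithTop ℝ) then P.coeff k else 0 := by
  classical
  simp only [initialForm, finsetSum_coeff, coeff_monomial, Finset.sum_ite_eq', Finset.mem_filter]
  refine if_congr ⟨fun ⟨_, hmin⟩ => ?_, fun hk => ⟨?_, fun l _ => ?_⟩⟩ rfl rfl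
  · have := hmin i (mem_support_iff.2 (ne_zero_of_map_eq_coe h.bot))
    rw [h.bot, ← WithTop.coe_add, sub_add_cancel, add_coe_le_coe_iff] at this
    exact le_antisymm this (h.le k)
  · exact mem_support_iff.2 (ne_zero_of_map_eq_coe hk)
  · rw [hk, ← WithTop.coe_add, sub_add_cancel, coe_le_add_coe_iff]
    exact h.le l

lemma HasEnds.coeff_initialForm_bot {P : K[X]} {m : ℝ} {i j : ℕ} (h : HasEnds v a P m i j) :
    (initialForm v a P).coeff i = P.coeff i := by
  classical rw [h.coeff_initialForm, if_pos h.bot]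

lemma HasEnds.coeff_initialForm_of_lt {P : K[X]} {m : ℝ} {i j : ℕ} (h : HasEnds v a P m i j)
    {k : ℕ} (hk : k < i) : (initialForm v a P).coeff k = 0 := by
  classical rw [h.coeff_initialForm, if_neg (h.lt_of_lt_bot k hk).ne']

lemma HasEnds.leadingCoeff_initialForm {P : K[X]} {m : ℝ} {i j : ℕ} (h : HasEnds v a P m i j) :
    (initialForm v a P).leadingCoeff = P.coeff j := by
  classical
  have hj : (initialForm v a P).coeff j = P.coeff j := by rw [h.coeff_initialForm, if_pos h.top]
  rw [leadingCoeff, natDegree_eq_of_le_of_coeff_ne_zero (n := j) _ _, hj]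
  · refine natDegree_le_iff_coeff_eq_zero.2 fun k hk => ?_
    rw [h.coeff_initialForm, if_neg (h.lt_of_top_lt k hk).ne']
  · rw [hj]
    exact ne_zero_of_map_eq_coe h.top

lemma HasEnds.initialForm_ne_zero {P : K[X]} {m : ℝ} {i j : ℕ} (h : HasEnds v a P m i j) :
    initialForm v a P ≠ 0 := by
  rw [← leadingCoeff_ne_zero, h.leadingCoeff_initialForm]
  exact ne_zero_of_map_eq_coe h.top

lemma hasEnds_C {u : K} (hu : u ≠ 0) : ∃ m, HasEnds v a (C u) m 0 0 := by
  obtain ⟨c, hc⟩ := WithTop.ne_top_iff_exists.1 (v.ne_top_iff.2 hu)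
  refine ⟨c, fun k => ?_, by simp [hc], by simp [hc], fun k hk => by omega, fun k hk => ?_⟩
  · rcases k with _ | k
    · simp [hc]
    · simp
  · rw [coeff_C, if_neg (by omega), v.map_zero]
    exact WithTop.coe_lt_top _

lemma hasEnds_X_sub_C_of_eq {r : K} (hr : v r = (a : WithTop ℝ)) :
    HasEnds v a (X - C r) a 0 1 := by
  refine ⟨fun k => ?_, by simp [hr], by simp, fun k hk => by omega, fun k hk => ?_⟩
  · rcases k with _ | _ | k
    · simp [hr]
    · simp
    · simp [coeff_X]
  · rw [coeff_sub, coeff_X, coeff_C, if_neg (by omega), if_neg (by omega), sub_zero, v.map_zero]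
    exact WithTop.coe_lt_top _

lemma hasEnds_X_sub_C_of_lt {r : K} (hr : (a : WithTop ℝ) < v r) :
    HasEnds v a (X - C r) a 1 1 := by
  refine ⟨fun k => ?_, by simp, by simp, fun k hk => ?_, fun k hk => ?_⟩
  · rcases k with _ | _ | k
    · simp [hr.le]
    · simp
    · simp [coeff_X]
  · obtain rfl : k = 0 := by omega
    simpa using hr
  · rw [coeff_sub, coeff_X, coeff_C, if_neg (by omega), if_neg (by omega), sub_zero, v.map_zero]
    exact WithTop.coe_lt_top _

lemma hasEnds_X_sub_C_of_gt {r : K} {c : ℝ} (hr : v r = (c : WithTop ℝ)) (hc : c < a) :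
    HasEnds v a (X - C r) c 0 0 := by
  have h : ∀ k : ℕ, 0 < k → ((c - a * k : ℝ) : WithTop ℝ) < v ((X - C r).coeff k) := by
    intro k hk
    rcases k with _ | _ | k
    · omega
    · have h1 : (X - C r).coeff (0 + 1) = 1 := by simp
      rw [h1, v.map_one, ← WithTop.coe_zero,
        WithTop.coe_lt_coe]
      push_cast
      linarith
    · rw [coeff_sub, coeff_X, coeff_C, if_neg (by omega), if_neg (by omega), sub_zero, v.map_zero]
      exact WithTop.coe_lt_top _
  refine ⟨fun k => ?_, by simp [hr], by simp [hr], fun k hk => by omega, h⟩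
  rcases k with _ | k
  · simp [hr]
  · exact (h _ (by omega)).le

end Ends

/-! ### Convexity and multiplicativity of the extreme coefficients -/

section Convex
variable {K : Type*} [Field K] [LinearOrder K] [IsStrictOrderedRing K]
  {v : AddValuation K (WithTop ℝ)} {a : ℝ}

/-- For a convex valuation ring, `v` is antitone in the absolute value. -/
lemma map_le_map_of_abs_le (hv : IsConvexSubring (valuationRing v)) {x y : K} (h : |x| ≤ |y|) :
    v y ≤ v x := by
  rcases eq_or_ne y 0 with rfl | hy
  · have : x = 0 := by simpa using h
    simp [this]
  have hxy : x / y ∈ (valuationRing v : Set K) := by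
    have h1 : |x / y| ≤ 1 := by
      rw [abs_div]
      exact div_le_one_of_le₀ h (abs_nonneg y)
    rw [hv]
    exact ⟨1, one_mem _, (le_abs_self _).trans h1, (neg_le_abs _).trans h1⟩
  have h0 : 0 ≤ v (x / y) := hxy
  calc v y ≤ v (x / y) + v y := le_add_of_nonneg_left h0
    _ = v x := by rw [← v.map_mul, div_mul_cancel₀ _ hy]

lemma sign_add_of_map_lt (hv : IsConvexSubring (valuationRing v)) {x y : K} (h : v x < v y) :
    SignType.sign (x + y) = SignType.sign x := by
  have hlt : |y| < |x| := by
    by_contra hle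
    exact absurd (map_le_map_of_abs_le hv (not_lt.1 hle)) (not_le.2 h)
  obtain ⟨h1, h2⟩ := abs_lt.1 hlt
  rcases lt_trichotomy x 0 with hx | rfl | hx
  · rw [abs_of_neg hx] at h1 h2
    rw [sign_neg hx, sign_neg (by linarith)]
  · simp at h
  · rw [abs_of_pos hx] at h1 h2
    rw [sign_pos hx, sign_pos (by linarith)]

/-- If `y` is dominated by `x` or has the same sign, then adding `y` to `x` causes no
cancellation. -/
lemma map_add_le_and_sign_add (hv : IsConvexSubring (valuationRing v)) {x y : K} (hx : x ≠ 0)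
    (h : v x < v y ∨ SignType.sign y = SignType.sign x) :
    v (x + y) ≤ v x ∧ SignType.sign (x + y) = SignType.sign x := by
  rcases h with h | h
  · exact ⟨(v.map_add_eq_of_lt_left h).le, sign_add_of_map_lt hv h⟩
  rcases hx.lt_or_gt with hx | hx
  · rw [sign_neg hx, sign_eq_neg_one_iff] at h
    refine ⟨map_le_map_of_abs_le hv ?_, by rw [sign_neg hx, sign_neg (by linarith)]⟩
    rw [abs_of_neg hx, abs_of_neg (by linarith)]
    linarith
  · rw [sign_pos hx, sign_eq_one_iff] at h
    refine ⟨map_le_map_of_abs_le hv ?_, by rw [sign_pos hx, sign_pos (by linarith)]⟩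
    rw [abs_of_pos hx, abs_of_pos (by linarith)]
    linarith

/-- A coefficient of `P * Q` in which a single product `p_i * q_j` has least valuation inherits its
valuation and its sign. -/
lemma coeff_mul_of_dominant (hv : IsConvexSubring (valuationRing v)) {P Q : K[X]} {i j : ℕ} {c : ℝ}
    (hc : v (P.coeff i * Q.coeff j) = (c : WithTop ℝ))
    (h : ∀ k l, k + l = i + j → k ≠ i → (c : WithTop ℝ) < v (P.coeff k * Q.coeff l)) :
    v ((P * Q).coeff (i + j)) = (c : WithTop ℝ) ∧
      SignType.sign ((P * Q).coeff (i + j)) =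
        SignType.sign (P.coeff i) * SignType.sign (Q.coeff j) := by
  have hmem : (i, j) ∈ Finset.HasAntidiagonal.antidiagonal (i + j) := by simp
  rw [coeff_mul, ← Finset.add_sum_erase _ _ hmem, ← sign_mul]
  have hlt : v (P.coeff i * Q.coeff j) <
      v (∑ x ∈ (Finset.HasAntidiagonal.antidiagonal (i + j)).erase (i, j), P.coeff x.1 * Q.coeff x.2) := by
    rw [hc]
    refine v.map_lt_sum' (WithTop.coe_lt_top c) fun x hx => ?_
    obtain ⟨hne, hx⟩ := Finset.mem_erase.1 hx
    rw [Finset.HasAntidiagonal.mem_antidiagonal] at hx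
    refine h _ _ hx fun h1 => hne (Prod.ext h1 ?_)
    simp only at h1 ⊢
    omega
  exact ⟨(v.map_add_eq_of_lt_left hlt).trans hc, sign_add_of_map_lt hv hlt⟩

/-- The extreme exponents of the initial form are additive and the signs of the extreme coefficients
are multiplicative, although the initial form itself is multiplicative only up to terms of higher
valuation. -/
lemma HasEnds.mul (hv : IsConvexSubring (valuationRing v)) {P Q : K[X]} {m n : ℝ} {i j k l : ℕ}
    (hP : HasEnds v a P m i j) (hQ : HasEnds v a Q n k l) :
    HasEnds v a (P * Q) (m + n) (i + k) (j + l) ∧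
      SignType.sign ((P * Q).coeff (i + k)) =
        SignType.sign (P.coeff i) * SignType.sign (Q.coeff k) ∧
      SignType.sign ((P * Q).coeff (j + l)) =
        SignType.sign (P.coeff j) * SignType.sign (Q.coeff l) := by
  have hsplit : ∀ {s x y : ℕ}, x + y = s → m + n - a * s = (m - a * x) + (n - a * y) := by
    rintro s x y rfl
    push_cast
    ring
  have hlt : ∀ {s x y : ℕ}, x + y = s →
      ((m - a * x : ℝ) : WithTop ℝ) < v (P.coeff x) ∨
        ((n - a * y : ℝ) : WithTop ℝ) < v (Q.coeff y) →
      ((m + n - a * s : ℝ) : WithTop ℝ) < v (P.coeff x * Q.coeff y) := by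
    intro s x y hs h
    rw [v.map_mul, hsplit hs]
    rcases h with h | h
    · rw [add_comm, add_comm (v _)]
      exact coe_add_lt_add (hQ.le y) h
    · exact coe_add_lt_add (hP.le x) h
  have hbot := coeff_mul_of_dominant hv (P := P) (Q := Q) (i := i) (j := k)
    (c := m + n - a * (i + k : ℕ))
    (by rw [v.map_mul, hP.bot, hQ.bot, ← WithTop.coe_add, hsplit rfl])
    (fun x y hs hx => hlt hs (by
      rcases hx.lt_or_gt with hx | hx
      · exact Or.inl (hP.lt_of_lt_bot x hx)
      · exact Or.inr (hQ.lt_of_lt_bot y (by omega))))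
  have htop := coeff_mul_of_dominant hv (P := P) (Q := Q) (i := j) (j := l)
    (c := m + n - a * (j + l : ℕ))
    (by rw [v.map_mul, hP.top, hQ.top, ← WithTop.coe_add, hsplit rfl])
    (fun x y hs hx => hlt hs (by
      rcases hx.lt_or_gt with hx | hx
      · exact Or.inr (hQ.lt_of_top_lt y (by omega))
      · exact Or.inl (hP.lt_of_top_lt x hx)))
  refine ⟨⟨fun s => ?_, hbot.1, htop.1, fun s hs => ?_, fun s hs => ?_⟩, hbot.2, htop.2⟩
  · rw [coeff_mul]
    refine v.map_le_sum fun x hx => ?_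
    rw [v.map_mul, hsplit (Finset.HasAntidiagonal.mem_antidiagonal.1 hx), WithTop.coe_add]
    exact add_le_add (hP.le _) (hQ.le _)
  · rw [coeff_mul]
    refine v.map_lt_sum' (WithTop.coe_lt_top _) fun x hx => ?_
    have hx := Finset.HasAntidiagonal.mem_antidiagonal.1 hx
    refine hlt hx ?_
    by_cases h : x.1 < i
    · exact Or.inl (hP.lt_of_lt_bot _ h)
    · exact Or.inr (hQ.lt_of_lt_bot _ (by omega))
  · rw [coeff_mul]
    refine v.map_lt_sum' (WithTop.coe_lt_top _) fun x hx => ?_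
    have hx := Finset.HasAntidiagonal.mem_antidiagonal.1 hx
    refine hlt hx ?_
    by_cases h : j < x.1
    · exact Or.inl (hP.lt_of_top_lt _ h)
    · exact Or.inr (hQ.lt_of_top_lt _ (by omega))

end Convex

/-! ### Parity of the number of roots -/

section Parity
variable {K : Type*} [Field K] [LinearOrder K] [IsStrictOrderedRing K]
  {v : AddValuation K (WithTop ℝ)} {a : ℝ}

/-- The signs of the two extreme coefficients of the initial form of `P` have product `(-1) ^ r`,
where `r` is the number of positive roots of `P` of valuation `a`. -/
def EndSignsCountRoots (v : AddValuation K (WithTop ℝ)) (a : ℝ) (P : K[X]) : Prop :=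
  ∃ m i j, HasEnds v a P m i j ∧
    SignType.sign (P.coeff i) * SignType.sign (P.coeff j) =
      (-1) ^ (P.roots.filter (fun α => v α = (a : WithTop ℝ) ∧ 0 < α)).card

lemma EndSignsCountRoots.mul (hv : IsConvexSubring (valuationRing v)) {P Q : K[X]}
    (hPQ : P * Q ≠ 0) (hP : EndSignsCountRoots v a P) (hQ : EndSignsCountRoots v a Q) :
    EndSignsCountRoots v a (P * Q) := by
  obtain ⟨m, i, j, h, hs⟩ := hP
  obtain ⟨n, k, l, h', hs'⟩ := hQ
  obtain ⟨hmul, hbot, htop⟩ := h.mul hv h'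
  refine ⟨m + n, i + k, j + l, hmul, ?_⟩
  rw [hbot, htop, roots_mul hPQ, Multiset.filter_add, Multiset.card_add, pow_add, ← hs, ← hs',
    mul_mul_mul_comm]

lemma signType_mul_self {ε : SignType} (hε : ε ≠ 0) : ε * ε = 1 := by
  revert ε
  decide

omit [IsStrictOrderedRing K] in
lemma endSignsCountRoots_C {u : K} (hu : u ≠ 0) : EndSignsCountRoots v a (C u) := by
  obtain ⟨m, h⟩ := hasEnds_C (v := v) (a := a) hu
  refine ⟨m, 0, 0, h, ?_⟩
  simp [signType_mul_self, hu]

lemma endSignsCountRoots_X_sub_C (r : K) : EndSignsCountRoots v a (X - C r) := by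
  by_cases hr : v r = (a : WithTop ℝ)
  · refine ⟨a, 0, 1, hasEnds_X_sub_C_of_eq hr, ?_⟩
    rw [roots_X_sub_C, Multiset.filter_singleton]
    rcases (ne_zero_of_map_eq_coe hr).lt_or_gt with h | h
    · rw [if_neg (fun h' => h'.2.not_gt h)]
      simp [h]
    · rw [if_pos ⟨hr, h⟩]
      simp [h]
  have hcard : (((X - C r).roots).filter (fun α => v α = (a : WithTop ℝ) ∧ 0 < α)).card = 0 := by
    rw [roots_X_sub_C, Multiset.filter_singleton, if_neg (fun h => hr h.1)]
    rfl
  rcases lt_or_gt_of_ne hr with h | h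
  · obtain ⟨c, hc⟩ := WithTop.ne_top_iff_exists.1 (ne_top_of_lt h)
    rw [← hc, WithTop.coe_lt_coe] at h
    refine ⟨c, 0, 0, hasEnds_X_sub_C_of_gt hc.symm h, ?_⟩
    rw [hcard, pow_zero, signType_mul_self]
    simpa [sign_eq_zero_iff] using ne_zero_of_map_eq_coe hc.symm
  · refine ⟨a, 1, 1, hasEnds_X_sub_C_of_lt h, ?_⟩
    rw [hcard]
    simp

variable [IsRealClosed K]

/-- A quadratic polynomial without roots has negative discriminant. -/
lemma four_mul_coeff_gt_of_roots_eq_zero {p : K[X]} (hd : p.natDegree = 2) (hr : p.roots = 0) :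
    p.coeff 1 ^ 2 < 4 * (p.coeff 0 * p.coeff 2) := by
  by_contra hle
  have hp : p ≠ 0 := by rintro rfl; simp at hd
  obtain ⟨d, hd'⟩ := IsRealClosed.nonneg_iff_isSquare.1
    (show 0 ≤ p.coeff 1 ^ 2 - 4 * (p.coeff 0 * p.coeff 2) by linarith)
  have hlead : p.coeff 2 ≠ 0 := by
    rw [← hd]
    exact leadingCoeff_ne_zero.2 hp
  have hroot : p.IsRoot ((d - p.coeff 1) / (2 * p.coeff 2)) := by
    rw [IsRoot, eval_eq_sum_range, hd]
    simp only [Finset.sum_range_succ, Finset.sum_range_zero]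
    field_simp
    linear_combination -hd'
  have := (mem_roots hp).2 hroot
  simp [hr] at this

lemma endSignsCountRoots_of_natDegree_eq_two (hv : IsConvexSubring (valuationRing v)) {p : K[X]}
    (hd : p.natDegree = 2) (hr : p.roots = 0) : EndSignsCountRoots v a p := by
  have hdisc := four_mul_coeff_gt_of_roots_eq_zero hd hr
  have hp : p ≠ 0 := by rintro rfl; simp at hd
  have hpos : 0 < p.coeff 0 * p.coeff 2 := by nlinarith [sq_nonneg (p.coeff 1)]
  obtain ⟨m, i, j, h⟩ := exists_hasEnds (v := v) (a := a) hp
  -- The middle exponent is never extreme, as `v (c_1 ^ 2) ≥ v (4 * c_0 * c_2) ≥ v (c_0 * c_2)`.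
  have hmid : v (p.coeff 0 * p.coeff 2) ≤ v (p.coeff 1) + v (p.coeff 1) := by
    have h4 : (0 : WithTop ℝ) ≤ v 4 := by
      have : (4 : K) ∈ valuationRing v := ofNat_mem _ 4
      exact this
    calc v (p.coeff 0 * p.coeff 2) ≤ v 4 + v (p.coeff 0 * p.coeff 2) := le_add_of_nonneg_left h4
      _ = v (4 * (p.coeff 0 * p.coeff 2)) := (v.map_mul _ _).symm
      _ ≤ v (p.coeff 1 * p.coeff 1) := by
        refine map_le_map_of_abs_le hv ?_
        rw [← sq, abs_of_nonneg (sq_nonneg _), abs_of_pos (by linarith)]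
        exact hdisc.le
      _ = _ := v.map_mul _ _
  have hcoe : ((m - a * (1 : ℕ) : ℝ) : WithTop ℝ) + ((m - a * (1 : ℕ) : ℝ) : WithTop ℝ) =
      ((m - a * (0 : ℕ) + (m - a * (2 : ℕ)) : ℝ) : WithTop ℝ) := by
    rw [← WithTop.coe_add, WithTop.coe_inj]
    push_cast
    ring
  have hle : ∀ k, v (p.coeff k) = ((m - a * k : ℝ) : WithTop ℝ) → k ≤ 2 := by
    intro k hk
    exact hd ▸ le_natDegree_of_ne_zero (ne_zero_of_map_eq_coe hk)
  have hi : i ≠ 1 := by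
    rintro rfl
    rw [h.bot, hcoe, v.map_mul, add_comm] at hmid
    refine absurd hmid (not_le.2 ?_)
    rw [add_comm (m - a * (0 : ℕ))]
    exact coe_add_lt_add (h.le 2) (h.lt_of_lt_bot 0 (by omega))
  have hj : j ≠ 1 := by
    rintro rfl
    rw [h.top, hcoe, v.map_mul] at hmid
    refine absurd hmid (not_le.2 ?_)
    exact coe_add_lt_add (h.le 0) (h.lt_of_top_lt 2 (by omega))
  have hsign : SignType.sign (p.coeff 0) = SignType.sign (p.coeff 2) := by
    rcases mul_pos_iff.1 hpos with ⟨h0, h2⟩ | ⟨h0, h2⟩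
    · rw [sign_pos h0, sign_pos h2]
    · rw [sign_neg h0, sign_neg h2]
  have hall : ∀ k, k ≠ 1 → k ≤ 2 → SignType.sign (p.coeff k) = SignType.sign (p.coeff 2) := by
    intro k hk hk'
    obtain rfl | rfl : k = 0 ∨ k = 2 := by omega
    · exact hsign
    · rfl
  refine ⟨m, i, j, h, ?_⟩
  rw [hall i hi (hle i h.bot), hall j hj (hle j h.top), hr, signType_mul_self]
  · simp
  · simpa [sign_eq_zero_iff] using (mul_ne_zero_iff.1 hpos.ne').2

lemma endSignsCountRoots_of_irreducible (hv : IsConvexSubring (valuationRing v)) {p : K[X]}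
    (hp : Irreducible p) : EndSignsCountRoots v a p := by
  by_cases hr : p.roots = 0
  · refine endSignsCountRoots_of_natDegree_eq_two hv ?_ hr
    have h2 := natDegree_le_two_of_irreducible hp
    have h0 := hp.natDegree_pos
    have h1 : p.natDegree ≠ 1 := by
      intro h1
      obtain ⟨x, hx⟩ := exists_root_of_degree_eq_one ((degree_eq_iff_natDegree_eq_of_pos one_pos).2 h1)
      have := (mem_roots hp.ne_zero).2 hx
      simp [hr] at this
    omega
  · obtain ⟨r, hr⟩ := Multiset.exists_mem_of_ne_zero hr
    obtain ⟨q, rfl⟩ := dvd_iff_isRoot.2 ((mem_roots hp.ne_zero).1 hr)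
    obtain ⟨u, hu, rfl⟩ := Polynomial.isUnit_iff.1
      ((hp.isUnit_or_isUnit rfl).resolve_left (not_isUnit_X_sub_C r))
    exact (endSignsCountRoots_X_sub_C r).mul hv hp.ne_zero (endSignsCountRoots_C hu.ne_zero)

/-- Both sides are multiplicative in `P`, so it suffices to treat irreducible polynomials. -/
lemma endSignsCountRoots (hv : IsConvexSubring (valuationRing v)) {P : K[X]} (hP : P ≠ 0) :
    EndSignsCountRoots v a P := by
  induction P using WfDvdMonoid.induction_on_irreducible with
  | zero => exact absurd rfl hP
  | unit u hu =>
    obtain ⟨c, hc, rfl⟩ := Polynomial.isUnit_iff.1 hu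
    exact endSignsCountRoots_C hc.ne_zero
  | mul Q p hQ hp ih => exact (endSignsCountRoots_of_irreducible hv hp).mul hv hP (ih hQ)

lemma modEq_two_of_neg_one_pow_eq {k l : ℕ} (h : (-1 : SignType) ^ k = (-1) ^ l) :
    k ≡ l [MOD 2] := by
  rcases k.even_or_odd with hk | hk <;> rcases l.even_or_odd with hl | hl
  · exact (Nat.even_iff.1 hk).trans (Nat.even_iff.1 hl).symm
  · rw [hk.neg_one_pow, hl.neg_one_pow] at h
    exact absurd h (by decide)
  · rw [hk.neg_one_pow, hl.neg_one_pow] at h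
    exact absurd h (by decide)
  · exact (Nat.odd_iff.1 hk).trans (Nat.odd_iff.1 hl).symm

lemma card_roots_modEq_signVariations_initialForm (hv : IsConvexSubring (valuationRing v)) {P : K[X]}
    (hP : P ≠ 0) :
    (P.roots.filter (fun α => v α = (a : WithTop ℝ) ∧ 0 < α)).card ≡
      (initialForm v a P).signVariations [MOD 2] := by
  obtain ⟨m, i, j, h, hs⟩ := endSignsCountRoots (a := a) hv hP
  have hpow := neg_one_pow_signVariations (p := initialForm v a P) (i := i)
    (by rw [h.coeff_initialForm_bot]; exact ne_zero_of_map_eq_coe h.bot)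
    (fun k hk => h.coeff_initialForm_of_lt hk)
  rw [h.coeff_initialForm_bot, h.leadingCoeff_initialForm, hs] at hpow
  exact modEq_two_of_neg_one_pow_eq hpow.symm

end Parity

/-! ### The upper bound -/

section Bound
variable {K : Type*} [Field K] [LinearOrder K] [IsStrictOrderedRing K]
  {v : AddValuation K (WithTop ℝ)} {a : ℝ}

omit [IsStrictOrderedRing K] in
lemma HasEnds.sign_initialForm_eq_iff {P : K[X]} {m : ℝ} {i j : ℕ} (h : HasEnds v a P m i j) {k : ℕ}
    {ε : SignType} (hε : ε ≠ 0) :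
    SignType.sign ((initialForm v a P).coeff k) = ε ↔
      v (P.coeff k) = ((m - a * k : ℝ) : WithTop ℝ) ∧ SignType.sign (P.coeff k) = ε := by
  classical
  rw [h.coeff_initialForm]
  split_ifs with hk
  · simp [hk]
  · rw [sign_zero]
    exact ⟨fun h => absurd h.symm hε, fun h => absurd h.1 hk⟩

/-- A linear factor with a positive root of valuation `a` lengthens the alternating chains of the
initial form. A coefficient `q_(k-1) - α * q_k` of the product can lose its sign or its minimality
only if both terms are minimal and cancel, and this does not happen where a block of equal signs
begins or ends. -/
lemma exists_alternates_X_sub_C_mul (hv : IsConvexSubring (valuationRing v)) {Q : K[X]} (hQ : Q ≠ 0)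
    {α : K} (hα : v α = (a : WithTop ℝ)) (hpos : 0 < α) {n : ℕ} {ε : SignType} (hε : ε ≠ 0) {N : ℕ}
    (h : Alternates (fun k => SignType.sign ((initialForm v a Q).coeff k)) (n + 1) ε N) :
    ∃ M, Alternates (fun k => SignType.sign ((initialForm v a ((X - C α) * Q)).coeff k))
      (n + 2) ε M := by
  obtain ⟨m, i, j, hends⟩ := exists_hasEnds (v := v) (a := a) hQ
  have hmul := ((hasEnds_X_sub_C_of_eq hα).mul hv hends).1
  have hval : ∀ k : ℕ, v (Q.coeff k) = ((m - a * k : ℝ) : WithTop ℝ) →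
      v (-α * Q.coeff k) = ((a + m - a * k : ℝ) : WithTop ℝ) := by
    intro k hk
    rw [v.map_mul, v.map_neg, hα, hk, ← WithTop.coe_add, add_sub_assoc]
  have hsgn : ∀ k, SignType.sign (-α * Q.coeff k) = -SignType.sign (Q.coeff k) := by
    intro k
    rw [sign_mul, Left.sign_neg, sign_pos hpos, neg_one_mul]
  have hcast : ∀ k : ℕ, a + m - a * (k + 1 : ℕ) = m - a * k := by
    intro k
    push_cast
    ring
  have hcoeff : ∀ k, ((X - C α) * Q).coeff (k + 1) = Q.coeff k + -α * Q.coeff (k + 1) := by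
    intro k
    rw [sub_mul, coeff_sub, coeff_X_mul, coeff_C_mul]
    ring
  have hother : ∀ (k : ℕ) (δ : SignType), δ ≠ 0 →
      SignType.sign ((initialForm v a Q).coeff k) ≠ δ →
      ((m - a * k : ℝ) : WithTop ℝ) < v (Q.coeff k) ∨ SignType.sign (Q.coeff k) = -δ := by
    intro k δ hδ hk
    rw [Ne, hends.sign_initialForm_eq_iff hδ, not_and] at hk
    rcases (hends.le k).lt_or_eq with hlt | heq
    · exact Or.inl hlt
    · refine Or.inr (signType_eq_neg ?_ hδ (hk heq.symm))
      simpa [sign_eq_zero_iff] using ne_zero_of_map_eq_coe heq.symm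
  refine h.succ_of_mul ?_ ?_ (B := (initialForm v a Q).natDegree + 1) ?_ hε
  · intro l δ hδ hl hprev
    rw [hends.sign_initialForm_eq_iff hδ] at hl
    rw [hmul.sign_initialForm_eq_iff (by simpa using hδ)]
    cases l with
    | zero =>
      have : ((X - C α) * Q).coeff 0 = -α * Q.coeff 0 := by simp [mul_coeff_zero]
      rw [this, hsgn, hl.2]
      exact ⟨hval 0 hl.1, rfl⟩
    | succ k =>
      have hdom := map_add_le_and_sign_add hv (x := -α * Q.coeff (k + 1)) (y := Q.coeff k)
        (ne_zero_of_map_eq_coe (hval _ hl.1)) (by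
          rw [hval _ hl.1, hsgn, hl.2, hcast]
          exact hother k δ hδ (hprev k rfl))
      rw [add_comm, ← hcoeff, hval _ hl.1, hsgn, hl.2] at hdom
      exact ⟨le_antisymm hdom.1 (hmul.le _), hdom.2⟩
  · intro k δ hδ hk hnext
    rw [hends.sign_initialForm_eq_iff hδ] at hk
    rw [hmul.sign_initialForm_eq_iff hδ]
    have hdom := map_add_le_and_sign_add hv (x := Q.coeff k) (y := -α * Q.coeff (k + 1))
      (ne_zero_of_map_eq_coe hk.1) (by
        rw [hk.1, hk.2, hsgn, neg_eq_iff_eq_neg]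
        rcases hother (k + 1) δ hδ hnext with h' | h'
        · left
          rw [v.map_mul, v.map_neg, hα, show m - a * k = a + (m - a * (k + 1 : ℕ)) by
            push_cast; ring]
          exact coe_add_lt_add le_rfl h'
        · exact Or.inr h')
    rw [← hcoeff, hk.1, hk.2, ← hcast k] at hdom
    exact ⟨le_antisymm hdom.1 (hmul.le _), hdom.2⟩
  · intro k hk
    rw [coeff_eq_zero_of_natDegree_lt (by omega), sign_zero]

lemma exists_alternates_prod_mul (hv : IsConvexSubring (valuationRing v)) {Q : K[X]} (hQ : Q ≠ 0)
    (s : Multiset K) (hs : ∀ α ∈ s, v α = (a : WithTop ℝ) ∧ 0 < α) :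
    ∃ ε ≠ 0, ∃ N, Alternates (fun k => SignType.sign
      ((initialForm v a ((s.map (fun α => X - C α)).prod * Q)).coeff k)) (s.card + 1) ε N := by
  induction s using Multiset.induction_on with
  | empty =>
    obtain ⟨m, i, j, h⟩ := exists_hasEnds (v := v) (a := a) hQ
    refine ⟨SignType.sign (Q.coeff i), ?_, i + 1, i, by omega, ?_, trivial⟩
    · simpa [sign_eq_zero_iff] using ne_zero_of_map_eq_coe h.bot
    · simp [h.coeff_initialForm_bot]
  | cons α s ih =>
    obtain ⟨ε, hε, N, h⟩ := ih fun β hβ => hs β (Multiset.mem_cons_of_mem hβ)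
    obtain ⟨hα, hpos⟩ := hs α (Multiset.mem_cons_self α s)
    have hne : (s.map (fun α => X - C α)).prod * Q ≠ 0 :=
      mul_ne_zero (monic_multisetProd_X_sub_C s).ne_zero hQ
    obtain ⟨M, hM⟩ := exists_alternates_X_sub_C_mul hv hne hα hpos hε h
    refine ⟨ε, hε, M, ?_⟩
    rw [Multiset.map_cons, Multiset.prod_cons, Multiset.card_cons, mul_assoc]
    exact hM

lemma card_roots_le_signVariations_initialForm (hv : IsConvexSubring (valuationRing v)) {P : K[X]}
    (hP : P ≠ 0) :
    (P.roots.filter (fun α => v α = (a : WithTop ℝ) ∧ 0 < α)).card ≤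
      (initialForm v a P).signVariations := by
  set s := P.roots.filter (fun α => v α = (a : WithTop ℝ) ∧ 0 < α)
  obtain ⟨Q, hQ⟩ := (Multiset.prod_X_sub_C_dvd_iff_le_roots hP s).2 (Multiset.filter_le _ _)
  have hQ0 : Q ≠ 0 := by
    rintro rfl
    exact hP (by rw [hQ, mul_zero])
  obtain ⟨ε, hε, N, h⟩ := exists_alternates_prod_mul (a := a) hv hQ0 s
    (fun α hα => (Multiset.mem_filter.1 hα).2)
  rw [← hQ] at h
  obtain ⟨m, i, j, hends⟩ := exists_hasEnds (v := v) (a := a) hP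
  have := h.le_signVariations_add hends.initialForm_ne_zero hε
  split_ifs at this <;> omega

end Bound

/-! ### Valuations of roots and edges -/

section Edge
variable {K : Type*} [Field K] {v : AddValuation K (WithTop ℝ)} {a : ℝ}

/-- The minimum is attained twice: otherwise a single term of `P(α)` would dominate. -/
lemma HasEnds.lt_of_isRoot {P : K[X]} {α : K} (hα : v α = (a : WithTop ℝ)) (hroot : P.IsRoot α)
    {m : ℝ} {i j : ℕ} (h : HasEnds v a P m i j) : i < j := by
  have hij : i ≤ j := by
    by_contra hlt
    exact (h.lt_of_top_lt i (not_le.1 hlt)).ne' h.bot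
  refine lt_of_le_of_ne hij ?_
  rintro rfl
  have hpow : ∀ k : ℕ, v (α ^ k) = ((a * k : ℝ) : WithTop ℝ) := by
    intro k
    rw [v.map_pow, hα, ← WithTop.coe_nsmul, nsmul_eq_mul, mul_comm]
  have hi : v (P.coeff i * α ^ i) = (m : WithTop ℝ) := by
    rw [v.map_mul, h.bot, hpow, ← WithTop.coe_add, sub_add_cancel]
  have hmem : i ∈ P.support := mem_support_iff.2 (ne_zero_of_map_eq_coe h.bot)
  have hlt : (m : WithTop ℝ) < v (∑ k ∈ P.support.erase i, P.coeff k * α ^ k) := by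
    refine v.map_lt_sum' (WithTop.coe_lt_top m) fun k hk => ?_
    have hne := (Finset.mem_erase.1 hk).1
    have hlt : ((m - a * k : ℝ) : WithTop ℝ) < v (P.coeff k) :=
      hne.lt_or_gt.elim (h.lt_of_lt_bot k) (h.lt_of_top_lt k)
    rw [v.map_mul, hpow, show m = a * k + (m - a * k) by ring, add_comm (v _)]
    exact coe_add_lt_add le_rfl hlt
  have hsum : P.coeff i * α ^ i + ∑ k ∈ P.support.erase i, P.coeff k * α ^ k = 0 := by
    rw [Finset.add_sum_erase _ (fun k => P.coeff k * α ^ k) hmem, ← hroot.eq_zero, eval_eq_sum,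
      Polynomial.sum]
  have := v.map_add_eq_of_lt_left (hi ▸ hlt)
  rw [hsum, v.map_zero, hi] at this
  simp at this

lemma newtonPoints_subset_newtonPolygon (P : K[X]) : newtonPoints v P ⊆ newtonPolygon v P :=
  fun z hz _ _ _ hb => hb z hz

/-- The supporting line of slope `-a` cuts out the edge. -/
lemma HasEnds.exists_isEdge {P : K[X]} {m : ℝ} {i j : ℕ} (h : HasEnds v a P m i j) (hij : i < j) :
    ∃ σ, IsEdge (newtonPolygon v P) σ ∧ HasSlope σ (-a) := by
  have hline : ∀ z ∈ newtonPolygon v P, m ≤ a * z.1 + z.2 := by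
    intro z hz
    have := hz (a, 1) zero_le_one m (by
      rintro s ⟨k, hk, hs⟩
      have := h.le k
      rw [hs, WithTop.coe_le_coe] at this
      simp only [hk]
      linarith)
    simpa using this
  have hfst : ∀ z ∈ newtonPolygon v P, 0 ≤ z.1 ∧ z.1 ≤ P.natDegree := by
    intro z hz
    have h0 := hz (1, 0) le_rfl 0 (by
      rintro s ⟨k, hk, hs⟩
      simp [hk])
    have h1 := hz (-1, 0) le_rfl (-P.natDegree) (by
      rintro s ⟨k, hk, hs⟩
      have : (k : ℝ) ≤ P.natDegree :=
        Nat.cast_le.2 (le_natDegree_of_ne_zero (ne_zero_of_map_eq_coe hs))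
      simp only [hk]
      linarith)
    simp only at h0 h1
    constructor <;> linarith
  have hmem : ∀ k : ℕ, v (P.coeff k) = ((m - a * k : ℝ) : WithTop ℝ) →
      ((k : ℝ), m - a * k) ∈ newtonPolygon v P :=
    fun k hk => newtonPoints_subset_newtonPolygon P ⟨k, rfl, hk⟩
  refine ⟨{z ∈ newtonPolygon v P | a * z.1 + z.2 = m}, ⟨?_, ?_, ?_⟩, ?_⟩
  · intro _
    refine ⟨-(a • ContinuousLinearMap.fst ℝ ℝ ℝ + ContinuousLinearMap.snd ℝ ℝ ℝ), ?_⟩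
    ext z
    simp only [Set.mem_ofPred_eq]
    refine and_congr_right fun hz => ⟨fun hzm w hw => ?_, fun hmax => ?_⟩
    · have := hline w hw
      simp
      linarith
    · have := hmax _ (hmem i h.bot)
      simp at this
      linarith [hline z hz]
  · refine ((Metric.isBounded_Icc (0 : ℝ) P.natDegree).prod
      (Metric.isBounded_Icc (m - |a| * P.natDegree) (m + |a| * P.natDegree))).subset ?_
    rintro z ⟨hz, hzm⟩
    obtain ⟨h0, h1⟩ := hfst z hz
    have habs : |a * z.1| ≤ |a| * P.natDegree := by
      rw [abs_mul, abs_of_nonneg h0]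
      gcongr
    obtain ⟨h2, h3⟩ := abs_le.1 habs
    exact ⟨⟨h0, h1⟩, by linarith, by linarith⟩
  · refine ⟨_, ⟨hmem i h.bot, by ring⟩, _, ⟨hmem j h.top, by ring⟩, fun heq => ?_⟩
    exact hij.ne (Nat.cast_injective (congrArg Prod.fst heq))
  · rintro z ⟨-, hz⟩ w ⟨-, hw⟩
    linear_combination hw - hz

end Edge

end NewtonSigns

theorem theoremB {K : Type*} [Field K] [LinearOrder K] [IsStrictOrderedRing K] [IsRealClosed K]
    (v : AddValuation K (WithTop ℝ))
    (hv : NewtonSigns.IsConvexSubring (NewtonSigns.valuationRing v))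
    (P : K[X]) (hP : P ≠ 0) :
    (∀ α : K, P.IsRoot α → α ≠ 0 →
      ∃ (σ : Set (ℝ × ℝ)) (s : ℝ), NewtonSigns.IsEdge (NewtonSigns.newtonPolygon v P) σ ∧
        NewtonSigns.HasSlope σ s ∧ v α = ((-s : ℝ) : WithTop ℝ)) ∧
    (∀ (σ : Set (ℝ × ℝ)) (s : ℝ), NewtonSigns.IsEdge (NewtonSigns.newtonPolygon v P) σ →
      NewtonSigns.HasSlope σ s →
        (P.roots.filter (fun α => v α = ((-s : ℝ) : WithTop ℝ) ∧ 0 < α)).card ≤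
            (NewtonSigns.initialForm v (-s) P).signVariations ∧
        (P.roots.filter (fun α => v α = ((-s : ℝ) : WithTop ℝ) ∧ 0 < α)).card ≡
            (NewtonSigns.initialForm v (-s) P).signVariations [MOD 2]) := by
  refine ⟨fun α hα hα0 => ?_, fun σ s _ _ =>
    ⟨NewtonSigns.card_roots_le_signVariations_initialForm hv hP,
      NewtonSigns.card_roots_modEq_signVariations_initialForm hv hP⟩⟩
  obtain ⟨a, ha⟩ := WithTop.ne_top_iff_exists.1 (v.ne_top_iff.2 hα0)
  obtain ⟨m, i, j, h⟩ := NewtonSigns.exists_hasEnds (v := v) (a := a) hP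
  obtain ⟨σ, hσ, hs⟩ := h.exists_isEdge (h.lt_of_isRoot ha.symm hα)
  exact ⟨σ, -a, hσ, hs, by rw [neg_neg, ha]⟩
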